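/- Identify functions with their graphs, and let $\mathfrak c=|\mathbb R|$. Consider the condition (A) There is a function $f\colon\mathbb R\to\mathbb R$ which is the union of a family $\{f_\alpha\colon\alpha<\mathfrak c\}$ of pairwise disjoint partial functions such that each $f_\alpha\subseteq\mathbb R^2$ has positive outer (planar Lebesgue) measure and $\{x\in\mathbb R\colon f(x)=g(x)\}$ is a null set for every continuous $g\colon\mathbb R\to\mathbb R$. For $F\colon\mathbb R^2\to\mathbb R$ and $f\colon\mathbb R\to\mathbb R$ put $F_f(x)=F(x,f(x))$. The function $F$ is sup-measurable if $F_f$ is Lebesgue measurable for every Lebesgue measurable $f\colon\mathbb R\to\mathbb R$, and weakly sup-measurable if $F_f$ is Lebesgue measurable for every continuous and almost everywhere differentiable $f\colon\mathbb R\to\mathbb R$. A subset $\mathcal A$ of a commutative $\mathbb R$-algebra is strongly $\kappa$-algebrable if $\mathcal A\cup\{0\}$ contains a (not necessarily unital) subalgebra generated by a set $X$ of cardinality $\kappa$ which is a free commutative algebra with $X$ as set of free generators, i.e. is isomorphic, via $X$, to the algebra of real polynomials without constant term in the variables $X$. Assume (A). Then the family of all weakly sup-measurable functions $F\colon\mathbb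 R^2\to\mathbb R$ that are not sup-measurable is a strongly $2^{\mathfrak c}$-algebrable subset of the algebra $\mathbb R^{\mathbb R^2}$ of all functions $\mathbb R^2\to\mathbb R$ with pointwise operations. -/

import Mathlib

open MeasureTheory

/-- The Carathéodory superposition `F_f (x) = F (x, f x)`. -/
def superposition (F : ℝ × ℝ → ℝ) (f : ℝ → ℝ) : ℝ → ℝ := fun x => F (x, f x)

/-- Lebesgue measurability of `f : ℝ → ℝ`: preimages of Borel sets belong to the completion of
the Borel σ-algebra with respect to Lebesgue measure. -/
def LebesgueMeasurable (f : ℝ → ℝ) : Prop := NullMeasurable f (volume : Measure ℝ)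

/-- `F` is sup-measurable. -/
def SupMeasurable (F : ℝ × ℝ → ℝ) : Prop :=
  ∀ f : ℝ → ℝ, LebesgueMeasurable f → LebesgueMeasurable (superposition F f)

/-- `F` is weakly sup-measurable. -/
def WeaklySupMeasurable (F : ℝ × ℝ → ℝ) : Prop :=
  ∀ f : ℝ → ℝ, Continuous f → (∀ᵐ x, DifferentiableAt ℝ f x) →
    LebesgueMeasurable (superposition F f)

/-- Condition (A). Functions are identified with their graphs, so the partial functions `fα i` are
pairwise disjoint sets in the plane whose union is the graph of `f`. A Mathlib measure evaluated
at an arbitrary set is the outer measure of this set. -/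
def ConditionA : Prop :=
  ∃ (f : ℝ → ℝ) (ι : Type) (fα : ι → Set (ℝ × ℝ)),
    Cardinal.mk ι = Cardinal.continuum ∧
    Pairwise (fun i j => Disjoint (fα i) (fα j)) ∧
    (⋃ i, fα i) = {p : ℝ × ℝ | p.2 = f p.1} ∧
    (∀ i, 0 < (volume : Measure (ℝ × ℝ)) (fα i)) ∧
    ∀ g : ℝ → ℝ, Continuous g → (volume : Measure ℝ) {x | f x = g x} = 0

/-- The free commutative (not necessarily unital) `R`-algebra on `σ`: the polynomials in the
variables `σ` without constant term. -/
def freeCommAlgebra (R σ : Type*) [CommRing R] : NonUnitalSubalgebra R (MvPolynomial σ R) where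
  carrier := {P | MvPolynomial.constantCoeff P = 0}
  zero_mem' := map_zero _
  add_mem' {a b} ha hb := by
    simp only [Set.mem_ofPred_eq] at ha hb ⊢
    rw [map_add, ha, hb, add_zero]
  mul_mem' {a b} ha _ := by
    simp only [Set.mem_ofPred_eq] at ha ⊢
    rw [map_mul, ha, zero_mul]
  smul_mem' c a ha := by
    simp only [Set.mem_ofPred_eq] at ha ⊢
    rw [MvPolynomial.constantCoeff_smul, ha, smul_zero]

/-- The free generator of `freeCommAlgebra R σ` that belongs to `s : σ`. -/
noncomputable def freeCommAlgebraGen (R : Type*) {σ : Type*} [CommRing R] (s : σ) :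
    freeCommAlgebra R σ :=
  ⟨MvPolynomial.X s, MvPolynomial.constantCoeff_X R s⟩

/-- `A` is strongly `κ`-algebrable: `A ∪ {0}` contains a subalgebra, generated by a set `X` of
cardinality `κ`, that is isomorphic to the free commutative algebra with `X` as set of free
generators. Subalgebras need not contain the unit. -/
def StronglyAlgebrable.{u, v} (R : Type u) {L : Type v} [CommRing R] [CommRing L] [Algebra R L]
    (κ : Cardinal.{v}) (A : Set L) : Prop :=
  ∃ X : Set L, Cardinal.mk X = κ ∧
    (NonUnitalAlgebra.adjoin R X : Set L) ⊆ A ∪ {0} ∧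
    ∃ e : freeCommAlgebra R X →ₙₐ[R] NonUnitalAlgebra.adjoin R X, Function.Bijective e ∧
      ∀ x : X, (e (freeCommAlgebraGen R x) : L) = x

/-!
Consider functions on the plane supported on the graph of a measurable `w : ℝ → ℝ` that agrees with
each almost everywhere differentiable function only on a null set. Superposition with a continuous
almost everywhere differentiable function then gives zero almost everywhere, while superposition
with `w` recovers an arbitrary, possibly non-measurable, function on the line.

For `w` we take `x ↦ ∑ k, (3 / 4) ^ k * d k x`, where `d k x` is the `k`-th binary digit of `x`.
Flipping this digit moves `x` by `2 ^ (-k)` and `w x` by `(3 / 4) ^ k`. A measurable set of positive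
measure contains, for all large `k`, a point `x` together with `x + 2 ^ (-k)` and `x - 2 ^ (-k)`, so
`w` is not Lipschitz on it. An almost everywhere differentiable function, however, is Lipschitz on
each of countably many sets that cover almost all of the line.

For the free generators, let `m` map reals to real polynomials in continuum many variables
so that all its fibers have full outer measure, and consider the functions `x ↦ (m x)(a)` for points
`a : ℝ → ℝ`. A polynomial in finitely many of them has the form `h ∘ m`. If it has no constant term
and is nonzero, then `h` is not constant, as polynomials take arbitrary values at finitely many
points. The level sets of `h ∘ m` thus cannot all be measurable.
-/

open Cardinal Filter Function Set Topology
open scoped NNReal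

universe u v w

namespace freeCommAlgebra

variable {R : Type u} {σ : Type v} {L : Type w} [CommRing R] [CommRing L] [Algebra R L]

theorem adjoin_range_gen :
    NonUnitalAlgebra.adjoin R (range (freeCommAlgebraGen R (σ := σ))) = ⊤ := by
  let B := NonUnitalAlgebra.adjoin R (range (freeCommAlgebraGen R (σ := σ)))
  have exists_eq_sub_constantCoeff (P : MvPolynomial σ R) :
      ∃ Q ∈ B, (Q : MvPolynomial σ R) = P - MvPolynomial.C (MvPolynomial.constantCoeff P) := by
    induction P using MvPolynomial.induction_on with
    | C c => exact ⟨0, zero_mem B, by simp⟩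
    | add P₁ P₂ h₁ h₂ =>
      obtain ⟨Q₁, hQ₁, e₁⟩ := h₁
      obtain ⟨Q₂, hQ₂, e₂⟩ := h₂
      refine ⟨Q₁ + Q₂, add_mem hQ₁ hQ₂, ?_⟩
      rw [NonUnitalSubalgebra.coe_add, e₁, e₂, map_add, map_add]
      ring
    | mul_X P s h =>
      obtain ⟨Q, hQ, e⟩ := h
      have hs : freeCommAlgebraGen R s ∈ B :=
        NonUnitalAlgebra.subset_adjoin R (mem_range_self s)
      refine ⟨Q * freeCommAlgebraGen R s +
        MvPolynomial.constantCoeff P • freeCommAlgebraGen R s,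
        add_mem (mul_mem hQ hs) (SMulMemClass.smul_mem _ hs), ?_⟩
      simp only [freeCommAlgebraGen, NonUnitalSubalgebra.coe_add, NonUnitalSubalgebra.coe_mul,
        NonUnitalSubalgebra.coe_smul, e, map_mul, MvPolynomial.constantCoeff_X, mul_zero, map_zero,
        MvPolynomial.smul_eq_C_mul]
      ring
  refine eq_top_iff.2 fun P _ => ?_
  obtain ⟨Q, hQ, e⟩ := exists_eq_sub_constantCoeff P
  rw [show MvPolynomial.constantCoeff (P : MvPolynomial σ R) = 0 from P.2, map_zero, sub_zero] at e
  rwa [← Subtype.ext e]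

/-- The homomorphism from the free commutative algebra that sends the generator of `s` to `f s`:
substitution of the family `f` into polynomials without constant term. -/
noncomputable def lift (f : σ → L) : freeCommAlgebra R σ →ₙₐ[R] L :=
  (MvPolynomial.aeval (R := R) f).toNonUnitalAlgHom.comp
    (NonUnitalSubalgebraClass.subtype (freeCommAlgebra R σ))

theorem lift_apply (f : σ → L) (P : freeCommAlgebra R σ) :
    lift f P = MvPolynomial.aeval f (P : MvPolynomial σ R) :=
  rfl

theorem lift_gen (f : σ → L) (s : σ) : lift f (freeCommAlgebraGen R s) = f s :=
  MvPolynomial.aeval_X f s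

theorem range_lift (f : σ → L) :
    NonUnitalAlgHom.range (lift (R := R) f) = NonUnitalAlgebra.adjoin R (range f) := by
  rw [← NonUnitalAlgebra.map_top, ← adjoin_range_gen, NonUnitalAlgHom.map_adjoin, ← range_comp]
  exact congrArg (fun g => NonUnitalAlgebra.adjoin R (range g)) (funext (lift_gen f))

theorem map_lift {M : Type*} [CommRing M] [Algebra R M] (φ : L →ₙₐ[R] M) (f : σ → L)
    (P : freeCommAlgebra R σ) : φ (lift f P) = lift (φ ∘ f) P := by
  have hle : NonUnitalAlgebra.adjoin R (range (freeCommAlgebraGen R (σ := σ))) ≤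
      NonUnitalAlgHom.equalizer (φ.comp (lift f)) (lift (φ ∘ f)) := by
    refine NonUnitalAlgebra.adjoin_le ?_
    rintro _ ⟨s, rfl⟩
    change φ (lift f (freeCommAlgebraGen R s)) = lift (φ ∘ f) (freeCommAlgebraGen R s)
    rw [lift_gen, lift_gen, comp_apply]
  rw [adjoin_range_gen] at hle
  exact hle (x := P) trivial

end freeCommAlgebra

section Algebrability

variable {R : Type u} {L : Type v} [CommRing R] [CommRing L] [Algebra R L] {A : Set L}

theorem stronglyAlgebrable_of_lift_coe_mem (h₀ : (0 : L) ∉ A) (X : Set L)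
    (hX : ∀ P : freeCommAlgebra R X, P ≠ 0 → freeCommAlgebra.lift ((↑) : X → L) P ∈ A) :
    StronglyAlgebrable R #X A := by
  let φ : freeCommAlgebra R X →ₙₐ[R] L := freeCommAlgebra.lift (↑)
  have hrange : NonUnitalAlgHom.range φ = NonUnitalAlgebra.adjoin R X := by
    rw [freeCommAlgebra.range_lift, Subtype.range_coe]
  have hinj : Injective φ := (injective_iff_map_eq_zero φ).2 fun P hP => by
    by_contra hne
    exact h₀ (hP ▸ hX P hne)
  refine ⟨X, rfl, ?_, NonUnitalAlgHom.codRestrict φ _ fun P => hrange.le (mem_range_self P),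
    ⟨(NonUnitalAlgHom.injective_codRestrict _ _ _).2 hinj, ?_⟩, freeCommAlgebra.lift_gen _⟩
  · intro y hy
    obtain ⟨P, rfl⟩ := hrange.ge hy
    obtain rfl | hP := eq_or_ne P 0
    · exact .inr (map_zero φ)
    · exact .inl (hX P hP)
  · rintro ⟨y, hy⟩
    obtain ⟨P, rfl⟩ := hrange.ge hy
    exact ⟨P, rfl⟩

theorem stronglyAlgebrable_of_lift_mem [Nontrivial R] {κ : Type v} (h₀ : (0 : L) ∉ A) (F : κ → L)
    (hF : ∀ P : freeCommAlgebra R κ, P ≠ 0 → freeCommAlgebra.lift F P ∈ A) :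
    StronglyAlgebrable R #κ A := by
  have hinj : Injective F := by
    intro i j hij
    by_contra hne
    have hgen : freeCommAlgebraGen R i - freeCommAlgebraGen R j ≠ 0 := fun h =>
      hne (MvPolynomial.X_injective (congrArg Subtype.val (sub_eq_zero.1 h)))
    refine h₀ ?_
    simpa only [map_sub, freeCommAlgebra.lift_gen, hij, sub_self] using hF _ hgen
  let e : κ ≃ range F := Equiv.ofInjective F hinj
  rw [mk_congr e]
  refine stronglyAlgebrable_of_lift_coe_mem h₀ (range F) fun P hP => ?_
  let Q : freeCommAlgebra R κ := ⟨MvPolynomial.rename e.symm P, by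
    change MvPolynomial.constantCoeff _ = 0
    rw [MvPolynomial.constantCoeff_rename]
    exact P.2⟩
  have hQ : Q ≠ 0 := fun h => hP <| Subtype.ext <|
    MvPolynomial.rename_injective _ e.symm.injective <|
      (congrArg Subtype.val h).trans (map_zero _).symm
  have hlift : freeCommAlgebra.lift F Q = freeCommAlgebra.lift (↑) P := by
    rw [freeCommAlgebra.lift_apply, freeCommAlgebra.lift_apply, MvPolynomial.aeval_rename]
    exact congrArg (MvPolynomial.aeval · _) <|
      funext fun x => congrArg Subtype.val (e.apply_symm_apply x)
  exact hlift ▸ hF Q hQ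

end Algebrability

section Interpolation

variable {σ K : Type*} [Field K]

theorem exists_mvPolynomial_eval_eq (V : Finset (σ → K)) (z : (σ → K) → K) :
    ∃ q : MvPolynomial σ K, ∀ a ∈ V, MvPolynomial.eval a q = z a := by
  let I (a : σ → K) : Ideal (MvPolynomial σ K) := RingHom.ker (MvPolynomial.eval a)
  have hmax (a : σ → K) : (I a).IsMaximal :=
    RingHom.ker_isMaximal_of_surjective _ fun c => ⟨MvPolynomial.C c, MvPolynomial.eval_C c⟩
  have hI : Injective I := by
    intro a b hab
    funext s
    have hs : MvPolynomial.X s - MvPolynomial.C (b s) ∈ I a := by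
      rw [hab]
      simp [I, RingHom.mem_ker]
    simpa only [I, RingHom.mem_ker, map_sub, MvPolynomial.eval_X, MvPolynomial.eval_C,
      sub_eq_zero] using hs
  obtain ⟨q, hq⟩ := Ideal.exists_forall_sub_mem_ideal (I := fun a : V => I a)
    (fun a b hab => Ideal.isCoprime_of_isMaximal (hI.ne (Subtype.coe_injective.ne hab)))
    fun a => MvPolynomial.C (z a)
  refine ⟨q, fun a ha => sub_eq_zero.1 ?_⟩
  simpa only [I, RingHom.mem_ker, map_sub, MvPolynomial.eval_C] using hq ⟨a, ha⟩

theorem exists_eval_eval_ne_zero [Infinite K] {P : MvPolynomial (σ → K) K} (hP : P ≠ 0) :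
    ∃ q : MvPolynomial σ K, MvPolynomial.eval (fun a => MvPolynomial.eval a q) P ≠ 0 := by
  obtain ⟨z, hz⟩ : ∃ z, MvPolynomial.eval z P ≠ 0 := by
    by_contra! h
    exact hP (MvPolynomial.funext fun z => by rw [h z, map_zero])
  obtain ⟨q, hq⟩ := exists_mvPolynomial_eval_eq P.vars z
  refine ⟨q, ?_⟩
  rwa [show MvPolynomial.eval (fun a => MvPolynomial.eval a q) P = MvPolynomial.eval z P from
    MvPolynomial.eval₂Hom_congr' rfl (fun a ha _ => hq a ha) rfl]

end Interpolation

section ThickFibers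

theorem exists_injective_mem {ι : Type u} {α : Type v} (S : ι → Set α)
    (hS : ∀ i, lift.{v} #ι ≤ lift.{u} #(S i)) : ∃ f : ι → α, Injective f ∧ ∀ i, f i ∈ S i := by
  obtain ⟨_, _, hord⟩ := exists_ord_eq_type_lt ι
  have exists_new (i : ι) (g : Iio i → α) : ∃ a ∈ S i, a ∉ range g := by
    by_contra! hsub
    refine (hS i).not_gt ?_
    calc lift.{u} #(S i) ≤ lift.{u} #(range g) := lift_le.2 (mk_le_mk_of_subset hsub)
      _ ≤ lift.{v} #(Iio i) := mk_range_le_lift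
      _ < lift.{v} #ι := lift_lt.2 (mk_Iio_lt i hord)
  choose next hmem hnew using exists_new
  let f : ι → α := wellFounded_lt.fix fun i g => next i fun j => g j j.2
  have hf (i : ι) : f i = next i fun j => f j := wellFounded_lt.fix_eq _ i
  have hne {i j : ι} (hij : i < j) : f i ≠ f j := fun h =>
    hnew j (fun k => f k) ⟨⟨i, hij⟩, h.trans (hf j)⟩
  exact ⟨f, Injective.of_lt_imp_ne fun _ _ => hne, fun i => hf i ▸ hmem i _⟩

variable {α : Type u} {β : Type v} [MeasurableSpace α] {μ : Measure α}

/-- Every fiber of `m` has full outer measure with respect to `μ`. This is expressed by saying that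
the fibers meet each measurable set of positive measure. -/
def HasThickFibers (m : α → β) (μ : Measure α) : Prop :=
  ∀ ⦃S : Set α⦄, MeasurableSet S → μ S ≠ 0 → SurjOn m S univ

theorem continuum_le_mk_of_measure_ne_zero [StandardBorelSpace α] [NullSingletonClass μ] {S : Set α}
    (hS : MeasurableSet S) (hμS : μ S ≠ 0) : 𝔠 ≤ #S := by
  have : StandardBorelSpace S := hS.standardBorel
  have hcount : ¬ Countable S := fun h => hμS ((countable_coe_iff.1 h).measure_zero μ)
  have e : S ≃ᵐ ℝ := PolishSpace.measurableEquivOfNotCountable hcount not_countable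
  have h := mk_congr_lift e.toEquiv
  rw [mk_real, lift_continuum, lift_uzero] at h
  exact h.ge

theorem mk_setOf_measurableSet_le_continuum [MeasurableSpace.CountablyGenerated α] :
    #{S : Set α | MeasurableSet S} ≤ 𝔠 := by
  obtain ⟨b, hb, rfl⟩ := MeasurableSpace.CountablyGenerated.isCountablyGenerated (α := α)
  exact MeasurableSpace.cardinal_measurableSet_le_continuum
    (hb.le_aleph0.trans aleph0_le_continuum)

theorem exists_hasThickFibers [StandardBorelSpace α] (μ : Measure α) [NullSingletonClass μ]
    [Nonempty β] (hβ : #β ≤ 𝔠) : ∃ m : α → β, HasThickFibers m μ := by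
  let ι := {S : Set α // MeasurableSet S ∧ μ S ≠ 0} × β
  have hι : #ι ≤ 𝔠 := by
    have hS : #{S : Set α // MeasurableSet S ∧ μ S ≠ 0} ≤ 𝔠 :=
      (mk_le_mk_of_subset fun S h => h.1).trans mk_setOf_measurableSet_le_continuum
    rw [mk_prod, ← continuum_mul_self]
    exact mul_le_mul' (lift_le_continuum.2 hS) (lift_le_continuum.2 hβ)
  obtain ⟨f, hf, hmem⟩ := exists_injective_mem (fun i : ι => i.1.1) fun i =>
    (lift_le_continuum.2 hι).trans <|
      continuum_le_lift.2 (continuum_le_mk_of_measure_ne_zero i.1.2.1 i.1.2.2)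
  refine ⟨extend f Prod.snd fun _ => Classical.arbitrary β, fun S hS hμS b _ => ?_⟩
  let i : ι := ⟨⟨S, hS, hμS⟩, b⟩
  exact ⟨f i, hmem i, hf.extend_apply _ _ i⟩

namespace HasThickFibers

variable {m : α → β}

theorem surjOn_of_nullMeasurableSet (hm : HasThickFibers m μ) {S : Set α}
    (hS : NullMeasurableSet S μ) (hμS : μ S ≠ 0) : SurjOn m S univ := by
  obtain ⟨T, hTS, hT, hae⟩ := hS.exists_measurable_subset_ae_eq
  exact (hm hT (measure_congr hae ▸ hμS)).mono hTS Subset.rfl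

theorem eq_of_nullMeasurable_comp {γ : Type*} [MeasurableSpace γ] [MeasurableSingletonClass γ]
    (hm : HasThickFibers m μ) (hμ : μ ≠ 0) {h : β → γ} (hh : NullMeasurable (h ∘ m) μ) (b c : β) :
    h b = h c := by
  by_contra hne
  let S := h ∘ m ⁻¹' {h b}
  have hS : NullMeasurableSet S μ := hh (measurableSet_singleton _)
  have hSnull : μ S = 0 := by
    by_contra hpos
    obtain ⟨x, hx, rfl⟩ := hm.surjOn_of_nullMeasurableSet hS hpos (mem_univ c)
    exact hne (mem_singleton_iff.1 hx).symm
  have hScnull : μ Sᶜ = 0 := by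
    by_contra hpos
    obtain ⟨x, hx, rfl⟩ := hm.surjOn_of_nullMeasurableSet hS.compl hpos (mem_univ b)
    exact hx rfl
  refine hμ (Measure.measure_univ_eq_zero.1 ?_)
  rw [← union_compl_self S]
  exact measure_union_null hSnull hScnull

end HasThickFibers

end ThickFibers

section Translates

variable {G : Type*} [AddGroup G] [TopologicalSpace G] [IsTopologicalAddGroup G]
  [MeasurableSpace G] [BorelSpace G] {μ : Measure G} [IsLocallyFiniteMeasure μ]
  [μ.InnerRegularCompactLTTop] [μ.IsAddRightInvariant] {E : Set G}

theorem tendsto_measure_diff_preimage_add_right (hE : MeasurableSet E) (hfin : μ E ≠ ⊤) :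
    Tendsto (fun t : G => μ (E \ (· + t) ⁻¹' E)) (𝓝 0) (𝓝 0) := by
  let τ (t : G) : C(G, G) := ⟨(· + t), by fun_prop⟩
  have hτ : Continuous τ := ContinuousMap.continuous_of_continuous_uncurry _ <| by
    change Continuous fun p : G × G => p.2 + p.1
    fun_prop
  have hτ₀ : τ 0 ⁻¹' E = E := by
    ext x
    simp [τ]
  have hmp (t : G) : MeasurePreserving (τ t) μ μ := measurePreserving_add_right μ t
  have h := tendsto_measure_symmDiff_preimage_nhds_zero (hτ.tendsto 0) (.of_forall hmp) (hmp 0)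
    hE.nullMeasurableSet hfin
  rw [hτ₀] at h
  exact tendsto_of_tendsto_of_tendsto_of_le_of_le tendsto_const_nhds h (fun _ => zero_le)
    fun t => measure_mono subset_union_right

theorem eventually_exists_mem_add_mem_add_mem [SigmaFinite μ] (hE : MeasurableSet E)
    (hpos : μ E ≠ 0) {ι : Type*} {l : Filter ι} {s t : ι → G} (hs : Tendsto s l (𝓝 0))
    (ht : Tendsto t l (𝓝 0)) : ∀ᶠ k in l, ∃ x ∈ E, x + s k ∈ E ∧ x + t k ∈ E := by
  obtain ⟨E', hE', hE'E, hpos', hfin⟩ :=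
    Measure.exists_subset_measure_lt_top hE (pos_iff_ne_zero.2 hpos)
  have h := tendsto_measure_diff_preimage_add_right hE' hfin.ne
  have hsum := (h.comp hs).add (h.comp ht)
  rw [add_zero] at hsum
  filter_upwards [hsum.eventually_lt_const hpos'] with k hk
  obtain ⟨x, hx, hnx⟩ := not_subset.1 fun hsub =>
    ((measure_union_le _ _).trans_lt hk).not_ge (measure_mono hsub)
  simp only [mem_union, Set.mem_sdiff, mem_preimage, hx, true_and, not_or, not_not] at hnx
  exact ⟨x, hE'E hx, hE'E hnx.1, hE'E hnx.2⟩

end Translates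

section DigitSeries

/-- The `k`-th binary digit of `x`; the digits of the fractional part have positive index. -/
noncomputable def binaryDigit (k : ℕ) (x : ℝ) : ℤ := ⌊2 ^ k * x⌋ % 2

/-- The series of the binary digits of `x` with weights `(3 / 4) ^ k`. The weights are summable,
but decay more slowly than the place values `(1 / 2) ^ k`, so that the series changes steeply when
a single digit is flipped. -/
noncomputable def digitSeries (x : ℝ) : ℝ := ∑' k, (3 / 4 : ℝ) ^ k * binaryDigit k x

theorem binaryDigit_eq_zero_or_one (k : ℕ) (x : ℝ) : binaryDigit k x = 0 ∨ binaryDigit k x = 1 :=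
  Int.emod_two_eq_zero_or_one _

theorem summable_digitSeries (x : ℝ) : Summable fun k => (3 / 4 : ℝ) ^ k * binaryDigit k x := by
  refine .of_norm_bounded
    (summable_geometric_of_lt_one (r := (3 / 4 : ℝ)) (by norm_num) (by norm_num)) fun k => ?_
  rw [norm_mul, Real.norm_of_nonneg (by positivity)]
  refine mul_le_of_le_one_right (by positivity) ?_
  obtain h | h := binaryDigit_eq_zero_or_one k x <;> simp [h]

theorem measurable_digitSeries : Measurable digitSeries := by
  refine Measurable.tsum fun k => measurable_const.mul ?_
  have hfloor : Measurable fun x : ℝ => ⌊2 ^ k * x⌋ := (measurable_const_mul _).floor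
  exact (measurable_of_countable fun n : ℤ => ((n % 2 : ℤ) : ℝ)).comp hfloor

theorem binaryDigit_add_int_div_of_lt {j k : ℕ} (hkj : k < j) (x : ℝ) (n : ℤ) :
    binaryDigit j (x + n / 2 ^ k) = binaryDigit j x := by
  obtain ⟨i, rfl⟩ := Nat.exists_eq_add_of_lt hkj
  have hshift : (2 : ℝ) ^ (k + i + 1) * (x + n / 2 ^ k) =
      2 ^ (k + i + 1) * x + ((2 * (2 ^ i * n) : ℤ) : ℝ) := by
    push_cast
    field_simp
    ring
  rw [binaryDigit, hshift, Int.floor_add_intCast, Int.add_mul_emod_self_left, binaryDigit]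

theorem floor_two_pow_mul_eq_div (j i : ℕ) (x : ℝ) :
    ⌊2 ^ j * x⌋ = ⌊2 ^ (j + i) * x⌋ / 2 ^ i := by
  have h := Int.floor_div_natCast (2 ^ (j + i) * x) (2 ^ i)
  push_cast at h
  rw [← h]
  congr 1
  field_simp
  ring

theorem floor_two_pow_mul_add_int_div (k : ℕ) (x : ℝ) (n : ℤ) :
    ⌊2 ^ k * (x + n / 2 ^ k)⌋ = ⌊2 ^ k * x⌋ + n := by
  rw [← Int.floor_add_intCast]
  congr 1
  field_simp

theorem binaryDigit_flip (j k : ℕ) (x : ℝ) :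
    binaryDigit j (x + (1 - 2 * binaryDigit k x : ℤ) / 2 ^ k) =
      if j = k then 1 - binaryDigit k x else binaryDigit j x := by
  set y := x + (1 - 2 * binaryDigit k x : ℤ) / 2 ^ k
  have hy : ⌊2 ^ k * y⌋ = ⌊2 ^ k * x⌋ + (1 - 2 * (⌊2 ^ k * x⌋ % 2)) :=
    floor_two_pow_mul_add_int_div _ _ _
  obtain hjk | rfl | hkj := lt_trichotomy j k
  · have hhalf : ⌊2 ^ k * y⌋ / 2 = ⌊2 ^ k * x⌋ / 2 := by lia
    obtain ⟨i, rfl⟩ := Nat.exists_eq_add_of_lt hjk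
    have hfloor : ⌊2 ^ j * y⌋ = ⌊2 ^ j * x⌋ := by
      rw [floor_two_pow_mul_eq_div j i y, floor_two_pow_mul_eq_div j i x,
        floor_two_pow_mul_eq_div (j + i) 1 y, floor_two_pow_mul_eq_div (j + i) 1 x, pow_one, hhalf]
    rw [if_neg hjk.ne, binaryDigit, hfloor, binaryDigit]
  · rw [if_pos rfl, binaryDigit, hy, binaryDigit]
    lia
  · rw [if_neg hkj.ne']
    exact binaryDigit_add_int_div_of_lt hkj x _

theorem digitSeries_flip_sub (k : ℕ) (x : ℝ) :
    digitSeries (x + (1 - 2 * binaryDigit k x : ℤ) / 2 ^ k) - digitSeries x =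
      (3 / 4) ^ k * (1 - 2 * binaryDigit k x) := by
  rw [digitSeries, digitSeries, ← (summable_digitSeries _).tsum_sub (summable_digitSeries _),
    tsum_eq_single k fun j hj => by rw [binaryDigit_flip, if_neg hj, sub_self],
    binaryDigit_flip, if_pos rfl]
  push_cast
  ring

theorem abs_digitSeries_sub_eq (k : ℕ) (x : ℝ) :
    |digitSeries (x + 1 / 2 ^ k) - digitSeries x| = (3 / 4) ^ k ∨
      |digitSeries (x + -1 / 2 ^ k) - digitSeries x| = (3 / 4) ^ k := by
  have h := digitSeries_flip_sub k x
  have hpos : (0 : ℝ) < (3 / 4) ^ k := by positivity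
  refine (binaryDigit_eq_zero_or_one k x).imp (fun hd => ?_) fun hd => ?_
  · rw [hd, mul_zero, sub_zero, Int.cast_one, Int.cast_zero, mul_zero, sub_zero, mul_one] at h
    rw [h, abs_of_pos hpos]
  · rw [hd, mul_one, show (1 - 2 : ℤ) = -1 by rfl, Int.cast_neg, Int.cast_one, mul_one,
      show (1 - 2 : ℝ) = -1 by norm_num, mul_neg_one] at h
    rw [h, abs_neg, abs_of_pos hpos]

theorem volume_eq_zero_of_measurableSet_of_lipschitzOnWith_digitSeries {K : ℝ≥0}
    {E : Set ℝ} (hE : MeasurableSet E) (h : LipschitzOnWith K digitSeries E) : volume E = 0 := by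
  by_contra hpos
  have hlim (c : ℝ) : Tendsto (fun k : ℕ => c / 2 ^ k) atTop (𝓝 0) :=
    tendsto_const_nhds.div_atTop (tendsto_pow_atTop_atTop_of_one_lt one_lt_two)
  have hgrow : Tendsto (fun k : ℕ => (3 / 2 : ℝ) ^ k) atTop atTop :=
    tendsto_pow_atTop_atTop_of_one_lt (by norm_num)
  obtain ⟨k, ⟨x, hx, hx₁, hx₂⟩, hk⟩ :=
    ((eventually_exists_mem_add_mem_add_mem hE hpos (hlim 1) (hlim (-1))).and
      (hgrow.eventually_gt_atTop (K : ℝ))).exists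
  have hne (c : ℝ) (hc : |c| = 1) (hmem : x + c / 2 ^ k ∈ E) :
      |digitSeries (x + c / 2 ^ k) - digitSeries x| ≠ (3 / 4) ^ k := by
    intro heq
    have hle := h.dist_le_mul _ hmem _ hx
    rw [Real.dist_eq, heq, Real.dist_eq, add_sub_cancel_left, abs_div, hc,
      abs_of_pos (by positivity), mul_one_div, le_div_iff₀ (by positivity), ← mul_pow,
      show (3 / 4 * 2 : ℝ) = 3 / 2 by norm_num] at hle
    exact hle.not_gt hk
  obtain h₁ | h₂ := abs_digitSeries_sub_eq k x
  · exact hne 1 (by simp) hx₁ h₁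
  · exact hne (-1) (by simp) hx₂ h₂

theorem volume_eq_zero_of_lipschitzOnWith_digitSeries {K : ℝ≥0} {E : Set ℝ}
    (h : LipschitzOnWith K digitSeries E) : volume E = 0 := by
  -- The set where `digitSeries` agrees with a Lipschitz extension contains `E` and is measurable.
  obtain ⟨g, hg, hEg⟩ := h.extend_real
  refine measure_mono_null (t := {x | digitSeries x = g x}) hEg <|
    volume_eq_zero_of_measurableSet_of_lipschitzOnWith_digitSeries (K := K)
      (measurableSet_eq_fun measurable_digitSeries hg.continuous.measurable) ?_
  intro x hx y hy
  rw [show digitSeries x = g x from hx, show digitSeries y = g y from hy]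
  exact hg x y

theorem volume_setOf_eq_digitSeries {g : ℝ → ℝ} (hd : ∀ᵐ x, DifferentiableAt ℝ g x) :
    volume {x | g x = digitSeries x} = 0 := by
  let D := {x | DifferentiableAt ℝ g x}
  obtain ⟨t, A, -, hD, happrox, -⟩ :=
    exists_closed_cover_approximatesLinearOn_of_hasFDerivWithinAt g D (fderiv ℝ g)
      (fun x hx => hx.hasFDerivAt.hasFDerivWithinAt) (fun _ => 1) fun _ => one_ne_zero
  have hnull (n : ℕ) : volume ({x | g x = digitSeries x} ∩ (D ∩ t n)) = 0 := by
    have hg : LipschitzOnWith (‖A n‖₊ + 1) g (D ∩ t n) :=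
      lipschitzOnWith_iff_restrict.2 (happrox n).lipschitz
    refine volume_eq_zero_of_lipschitzOnWith_digitSeries (K := ‖A n‖₊ + 1) fun x hx y hy => ?_
    rw [← show g x = digitSeries x from hx.1, ← show g y = digitSeries y from hy.1]
    exact hg hx.2 hy.2
  refine measure_mono_null ?_ (measure_union_null hd (measure_iUnion_null hnull))
  intro x hx
  by_cases hxD : x ∈ D
  · obtain ⟨n, hn⟩ := mem_iUnion.1 (hD hxD)
    exact .inr (mem_iUnion.2 ⟨n, hx, hxD, hn⟩)
  · exact .inl hxD

end DigitSeries

section GraphExtension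

/-- The function on the plane that equals `u x` at the point `(x, w x)` of the graph of `w` and
vanishes off the graph, as a homomorphism in `u`. -/
noncomputable def graphExtension (w : ℝ → ℝ) : (ℝ → ℝ) →ₙₐ[ℝ] (ℝ × ℝ → ℝ) where
  toFun u := {p : ℝ × ℝ | p.2 = w p.1}.indicator (u ∘ Prod.fst)
  map_smul' c u := indicator_const_smul _ c (u ∘ Prod.fst)
  map_zero' := indicator_zero' _
  map_add' u v := indicator_add _ (u ∘ Prod.fst) (v ∘ Prod.fst)
  map_mul' u v := indicator_mul _ (u ∘ Prod.fst) (v ∘ Prod.fst)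

variable {w u : ℝ → ℝ}

theorem graphExtension_apply_of_ne {x y : ℝ} (h : y ≠ w x) : graphExtension w u (x, y) = 0 :=
  indicator_of_notMem (s := {p : ℝ × ℝ | p.2 = w p.1}) (a := (x, y)) h _

theorem superposition_graphExtension_self : superposition (graphExtension w u) w = u :=
  funext fun x => indicator_of_mem (s := {p : ℝ × ℝ | p.2 = w p.1}) (a := (x, w x)) rfl _

theorem lebesgueMeasurable_zero : LebesgueMeasurable 0 :=
  measurable_zero.nullMeasurable

theorem weaklySupMeasurable_graphExtension
    (hw : ∀ g : ℝ → ℝ, Continuous g → (∀ᵐ x, DifferentiableAt ℝ g x) →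
      volume {x | g x = w x} = 0) (u : ℝ → ℝ) :
    WeaklySupMeasurable (graphExtension w u) := by
  intro g hg hd
  refine lebesgueMeasurable_zero.congr ?_
  filter_upwards [measure_eq_zero_iff_ae_notMem.1 (hw g hg hd)] with x hx
  exact (graphExtension_apply_of_ne hx).symm

theorem not_supMeasurable_graphExtension (hw : LebesgueMeasurable w)
    (hu : ¬ LebesgueMeasurable u) : ¬ SupMeasurable (graphExtension w u) := by
  intro h
  rw [← superposition_graphExtension_self (w := w) (u := u)] at hu
  exact hu (h w hw)

end GraphExtension

theorem not_lebesgueMeasurable_lift_eval {m : ℝ → MvPolynomial ℝ ℝ}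
    (hm : HasThickFibers m volume) {P : freeCommAlgebra ℝ (ℝ → ℝ)} (hP : P ≠ 0) :
    ¬ LebesgueMeasurable
      (freeCommAlgebra.lift (fun (a : ℝ → ℝ) (x : ℝ) => MvPolynomial.eval a (m x)) P) := by
  let h (q : MvPolynomial ℝ ℝ) : ℝ := MvPolynomial.eval (fun a => MvPolynomial.eval a q) P.1
  have hcomp : freeCommAlgebra.lift (fun a x => MvPolynomial.eval a (m x)) P = h ∘ m := by
    funext x
    exact MvPolynomial.comp_aeval_apply _ (Pi.evalAlgHom ℝ (fun _ : ℝ => ℝ) x) P.1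
  have hzero : h 0 = 0 := by
    simpa only [h, map_zero] using (DFunLike.congr_fun MvPolynomial.eval_zero' P.1).trans P.2
  obtain ⟨q, hq⟩ := exists_eval_eval_ne_zero fun h₀ => hP (Subtype.ext h₀)
  rw [hcomp]
  exact fun hmeas => hq ((hm.eq_of_nullMeasurable_comp (NeZero.ne _) hmeas q 0).trans hzero)

theorem mainTheorem4_general :
    StronglyAlgebrable ℝ (2 ^ 𝔠) {F : ℝ × ℝ → ℝ | WeaklySupMeasurable F ∧ ¬ SupMeasurable F} := by
  obtain ⟨m, hm⟩ : ∃ m : ℝ → MvPolynomial ℝ ℝ, HasThickFibers m volume := by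
    refine exists_hasThickFibers volume (MvPolynomial.cardinalMk_le_max.trans ?_)
    simp [mk_real, aleph0_le_continuum]
  let u (a : ℝ → ℝ) (x : ℝ) : ℝ := MvPolynomial.eval a (m x)
  have hcard : (2 : Cardinal) ^ 𝔠 = #(ℝ → ℝ) := by
    rw [← power_def, mk_real, power_self_eq aleph0_le_continuum]
  rw [hcard]
  refine stronglyAlgebrable_of_lift_mem (fun h => h.2 fun _ _ => lebesgueMeasurable_zero)
    (graphExtension digitSeries ∘ u) fun P hP => ?_
  rw [← freeCommAlgebra.map_lift]
  exact ⟨weaklySupMeasurable_graphExtension (fun _ _ hg => volume_setOf_eq_digitSeries hg) _,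
    not_supMeasurable_graphExtension measurable_digitSeries.nullMeasurable
      (not_lebesgueMeasurable_lift_eval hm hP)⟩

theorem mainTheorem4 (hA : ConditionA) :
    StronglyAlgebrable ℝ (2 ^ Cardinal.continuum)
      {F : ℝ × ℝ → ℝ | WeaklySupMeasurable F ∧ ¬ SupMeasurable F} :=
  mainTheorem4_general
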